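/- Let $X$ be a finite non-empty set, let $\Delta_X$ be the simplex of probability distributions on $X$ (with its Euclidean topology), and let $\mathrm{DMC}_{X,[n]}$ be the set of channels $W=(W(y|x))_{x\in X,\,y\in[n]}$ from $X$ to $[n]=\{1,\dots,n\}$, i.e. $W(\cdot|x)$ is a probability distribution on $[n]$ for every $x\in X$. A channel $W'$ from $X$ to $[n']$ is degraded from $W\in\mathrm{DMC}_{X,[n]}$ if there is a channel $V$ from $[n]$ to $[n']$ with $W'(z|x)=\sum_y V(z|y)W(y|x)$; two channels are equivalent if each is degraded from the other. Let $\mathrm{DMC}^{(o)}_{X,*}$ be the quotient of $\coprod_{n\ge 1}\mathrm{DMC}_{X,[n]}$ by this equivalence relation. Noisiness topology. For $m\ge 1$ and a probability distribution $p$ on $[m]\times X$ put $P_c(p,W)=\sup_{D\in\mathrm{DMC}_{[n],[m]}}\sum_{u,x,y}p(u,x)W(y|x)D(u|y)$; this depends only on the equivalence class of $W$. The noisiness topology on $\mathrm{DMC}^{(o)}_{X,*}$ is the topology induced by the distance $$d(\hat W,\hat W')=\sup_{m\ge 1,\ p\in\Delta_{[m]\times X}}|P_c(p,\hat W)-P_c(p,\hat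 W')|.$$ Weak-$*$ topology. For $W\in\mathrm{DMC}_{X,[n]}$ let $P_W^o(y)=\frac1{|X|}\sum_x W(y|x)$ and, when $P_W^o(y)>0$, let $W_y^{-1}\in\Delta_X$ be given by $W_y^{-1}(x)=\frac{W(y|x)}{|X|P_W^o(y)}$. The Blackwell measure of $W$ is $\mathrm{MP}_W=\sum_{y:\,P_W^o(y)>0}P_W^o(y)\,\delta_{W_y^{-1}}$. It depends only on the class $\hat W$ of $W$, and $\hat W\mapsto \mathrm{MP}_{\hat W}$ is a bijection from $\mathrm{DMC}^{(o)}_{X,*}$ onto the set $\mathcal{MP}_{bf}(X)$ of Borel probability measures $\mu$ on $\Delta_X$ that have finite support and are balanced, i.e. $\int p\,d\mu(p)$ is the uniform distribution on $X$. Let $F_{\mathrm{can}}:\mathcal{MP}_{bf}(X)\to\mathrm{DMC}^{(o)}_{X,*}$ be the inverse bijection. A set $U\subset\mathrm{DMC}^{(o)}_{X,*}$ is open in the weak-$*$ topology on $\mathrm{DMC}^{(o)}_{X,*}$ if and only if $F_{\mathrm{can}}^{-1}(U)$ is open in $\mathcal{MP}_{bf}(X)$ for the subspace topology of the weak-$*$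 topology on Borel probability measures on $\Delta_X$ (the coarsest topology making $\mu\mapsto\int f\,d\mu$ continuous for every bounded continuous $f:\Delta_X\to\mathbb R$). Theorem. The weak-$*$ topology on $\mathrm{DMC}^{(o)}_{X,*}$ is the same as the noisiness topology on $\mathrm{DMC}^{(o)}_{X,*}$. -/

import Mathlib

open MeasureTheory

noncomputable section

namespace DMCSpace

/-! ### Channels, degradation, and the space of equivalent channels -/

/-- `DMC X Y` is the set of channels with input alphabet `X` and output alphabet `Y`, seen as
families of probability distributions on `Y` indexed by `X`; `W x y` is `W(y|x)`. -/
abbrev DMC (X Y : Type*) [Fintype Y] : Type _ := X → stdSimplex ℝ Y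

section Channels

variable {X Y Z T : Type*} [Fintype Y] [Fintype Z] [Fintype T]

/-- The composition `V ∘ W`: `(V ∘ W)(z|x) = ∑ y, V(z|y) W(y|x)`. -/
def comp (V : DMC Y Z) (W : DMC X Y) : DMC X Z := fun x =>
  ⟨fun z => ∑ y, V y z * W x y,
    fun z => Finset.sum_nonneg fun y _ =>
      mul_nonneg (stdSimplex.zero_le (V y) z) (stdSimplex.zero_le (W x) y),
    by
      rw [Finset.sum_comm]
      simp [← Finset.sum_mul]⟩

@[simp]
theorem comp_apply (V : DMC Y Z) (W : DMC X Y) (x : X) (z : Z) :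
    comp V W x z = ∑ y, V y z * W x y := rfl

/-- `W'` is degraded from `W` if `W' = V ∘ W` for some channel `V`. -/
def IsDegradedFrom (W' : DMC X Z) (W : DMC X Y) : Prop := ∃ V : DMC Y Z, W' = comp V W

/-- Two channels with the same input alphabet are equivalent if each is degraded from the other. -/
def IsEquivalent (W : DMC X Y) (W' : DMC X Z) : Prop :=
  IsDegradedFrom W' W ∧ IsDegradedFrom W W'

theorem IsDegradedFrom.refl (W : DMC X Y) : IsDegradedFrom W W := by
  classical
  refine ⟨fun y => ⟨Pi.single y 1, single_mem_stdSimplex ℝ y⟩, ?_⟩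
  funext x
  refine DFunLike.ext _ _ fun z => ?_
  have h : ∀ y, ((⟨Pi.single y 1, single_mem_stdSimplex ℝ y⟩ : stdSimplex ℝ Y) z)
      = if z = y then 1 else 0 := fun y => Pi.single_apply y (1 : ℝ) z
  simp [h]

theorem IsDegradedFrom.trans {W : DMC X Y} {W' : DMC X Z} {W'' : DMC X T}
    (h' : IsDegradedFrom W'' W') (h : IsDegradedFrom W' W) : IsDegradedFrom W'' W := by
  obtain ⟨V, rfl⟩ := h
  obtain ⟨V', rfl⟩ := h'
  refine ⟨comp V' V, ?_⟩
  funext x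
  refine DFunLike.ext _ _ fun t => ?_
  simp only [comp_apply, Finset.mul_sum, Finset.sum_mul]
  rw [Finset.sum_comm]
  simp only [mul_assoc]

end Channels

/-- Channels with input alphabet `X` and output alphabet `[n]` for some `n ≥ 1`: the disjoint
union of the sets `DMC X [n]`. -/
abbrev AllDMC (X : Type*) : Type _ := Σ n : ℕ+, DMC X (Fin n)

/-- Equivalence of channels, as an equivalence relation on `AllDMC X`. -/
abbrev channelSetoid (X : Type*) : Setoid (AllDMC X) where
  r W W' := IsEquivalent W.2 W'.2
  iseqv :=
    { refl := fun _ => ⟨.refl _, .refl _⟩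
      symm := fun h => ⟨h.2, h.1⟩
      trans := fun h h' => ⟨h'.1.trans h.1, h.2.trans h'.2⟩ }

/-- The space of equivalent channels with input alphabet `X`. -/
def EquivDMC (X : Type*) : Type _ := Quotient (channelSetoid X)

/-! ### The noisiness topology -/

section Noisiness

variable {X Y Z : Type*} [Fintype X] [Fintype Y] [Fintype Z] {m : ℕ+}

/-- The probability of guessing `U` correctly with the decoder `D`, when `(U, X)` has
distribution `p` and `X` is sent through `W`. -/
def probCorrectWith (p : stdSimplex ℝ (Fin m × X)) (W : DMC X Y) (D : DMC Y (Fin m)) : ℝ :=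
  ∑ u, ∑ x, ∑ y, p (u, x) * W x y * D y u

/-- `P_c(p, W)`: the optimal probability of correctly guessing `U` from the output of `W`. -/
def probCorrect (p : stdSimplex ℝ (Fin m × X)) (W : DMC X Y) : ℝ :=
  ⨆ D : DMC Y (Fin m), probCorrectWith p W D

theorem probCorrectWith_nonneg (p : stdSimplex ℝ (Fin m × X)) (W : DMC X Y)
    (D : DMC Y (Fin m)) : 0 ≤ probCorrectWith p W D :=
  Finset.sum_nonneg fun _ _ => Finset.sum_nonneg fun _ _ => Finset.sum_nonneg fun _ _ =>
    mul_nonneg (mul_nonneg (stdSimplex.zero_le _ _) (stdSimplex.zero_le _ _))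
      (stdSimplex.zero_le _ _)

theorem probCorrectWith_le_one (p : stdSimplex ℝ (Fin m × X)) (W : DMC X Y)
    (D : DMC Y (Fin m)) : probCorrectWith p W D ≤ 1 := by
  calc probCorrectWith p W D ≤ ∑ u, ∑ x, ∑ y, p (u, x) * W x y := by
        refine Finset.sum_le_sum fun u _ => Finset.sum_le_sum fun x _ =>
          Finset.sum_le_sum fun y _ => ?_
        exact mul_le_of_le_one_right
          (mul_nonneg (stdSimplex.zero_le _ _) (stdSimplex.zero_le _ _)) (stdSimplex.le_one _ _)
    _ = ∑ u, ∑ x, p (u, x) := by simp [← Finset.mul_sum]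
    _ = 1 := by rw [← Fintype.sum_prod_type']; exact stdSimplex.sum_eq_one p

theorem bddAbove_probCorrectWith (p : stdSimplex ℝ (Fin m × X)) (W : DMC X Y) :
    BddAbove (Set.range fun D : DMC Y (Fin m) => probCorrectWith p W D) :=
  ⟨1, by rintro _ ⟨D, rfl⟩; exact probCorrectWith_le_one p W D⟩

theorem probCorrect_nonneg (p : stdSimplex ℝ (Fin m × X)) (W : DMC X Y) : 0 ≤ probCorrect p W :=
  Real.iSup_nonneg fun D => probCorrectWith_nonneg p W D

theorem probCorrect_le_one (p : stdSimplex ℝ (Fin m × X)) (W : DMC X Y) : probCorrect p W ≤ 1 :=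
  Real.iSup_le (fun D => probCorrectWith_le_one p W D) zero_le_one

theorem IsDegradedFrom.probCorrect_le {W' : DMC X Z} {W : DMC X Y} (h : IsDegradedFrom W' W)
    (p : stdSimplex ℝ (Fin m × X)) : probCorrect p W' ≤ probCorrect p W := by
  obtain ⟨V, rfl⟩ := h
  refine Real.iSup_le (fun D => ?_) (probCorrect_nonneg p W)
  refine le_trans (le_of_eq ?_) (le_ciSup (bddAbove_probCorrectWith p W) (comp D V))
  refine Finset.sum_congr rfl fun u _ => Finset.sum_congr rfl fun x _ => ?_
  simp only [comp_apply, Finset.mul_sum, Finset.sum_mul]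
  rw [Finset.sum_comm]
  refine Finset.sum_congr rfl fun y _ => Finset.sum_congr rfl fun z _ => ?_
  ring

/-- `P_c(p, Ŵ) := P_c(p, W')` for any `W' ∈ Ŵ`. -/
def EquivDMC.probCorrect (p : stdSimplex ℝ (Fin m × X)) (w : EquivDMC X) : ℝ :=
  Quotient.lift (fun W : AllDMC X => DMCSpace.probCorrect p W.2)
    (fun W W' (h : IsEquivalent W.2 W'.2) => le_antisymm (h.2.probCorrect_le p)
      (h.1.probCorrect_le p)) w

theorem EquivDMC.probCorrect_nonneg (p : stdSimplex ℝ (Fin m × X)) (w : EquivDMC X) :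
    0 ≤ w.probCorrect p := by
  induction w using Quotient.inductionOn with
  | h W => exact DMCSpace.probCorrect_nonneg p W.2

theorem EquivDMC.probCorrect_le_one (p : stdSimplex ℝ (Fin m × X)) (w : EquivDMC X) :
    w.probCorrect p ≤ 1 := by
  induction w using Quotient.inductionOn with
  | h W => exact DMCSpace.probCorrect_le_one p W.2

/-- The noisiness distance: the supremum over all `m ≥ 1` and all probability distributions `p`
on `[m] × X` of `|P_c(p, w) - P_c(p, w')|`. -/
def noisinessDist (w w' : EquivDMC X) : ℝ :=
  ⨆ q : Σ m : ℕ+, stdSimplex ℝ (Fin m × X), |w.probCorrect q.2 - w'.probCorrect q.2|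

theorem bddAbove_noisiness (w w' : EquivDMC X) :
    BddAbove (Set.range fun q : Σ m : ℕ+, stdSimplex ℝ (Fin m × X) =>
      |w.probCorrect q.2 - w'.probCorrect q.2|) := by
  refine ⟨1, ?_⟩
  rintro _ ⟨q, rfl⟩
  have h1 := w.probCorrect_nonneg q.2
  have h2 := w.probCorrect_le_one q.2
  have h3 := w'.probCorrect_nonneg q.2
  have h4 := w'.probCorrect_le_one q.2
  exact abs_le.2 ⟨by linarith, by linarith⟩

variable (X) in
/-- The noisiness distance as a (pseudo)metric. -/
abbrev noisinessMetric : PseudoMetricSpace (EquivDMC X) where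
  dist := noisinessDist
  dist_self w := by simp [noisinessDist]
  dist_comm w w' := by simp only [noisinessDist, abs_sub_comm]
  dist_triangle w₁ w₂ w₃ := by
    refine Real.iSup_le (fun q => ?_) (add_nonneg (Real.iSup_nonneg fun _ => abs_nonneg _)
      (Real.iSup_nonneg fun _ => abs_nonneg _))
    exact (abs_sub_le _ (w₂.probCorrect q.2) _).trans
      (add_le_add (le_ciSup (bddAbove_noisiness w₁ w₂) q)
        (le_ciSup (bddAbove_noisiness w₂ w₃) q))

variable (X) in
/-- The noisiness topology: the topology on `EquivDMC X` induced by the noisiness distance. -/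
abbrev noisinessTopology : TopologicalSpace (EquivDMC X) :=
  (noisinessMetric X).toUniformSpace.toTopologicalSpace

end Noisiness

/-! ### Blackwell measures -/

section Blackwell

variable {X Y Z : Type*} [Fintype X] [Fintype Y] [Fintype Z]

/-- `P_W^o(y) = (1/|X|) ∑ x, W(y|x)`: the output distribution for a uniform input. -/
def outputProb (W : DMC X Y) (y : Y) : ℝ := (Fintype.card X : ℝ)⁻¹ * ∑ x, W x y

/-- `Im(W)`: the set of output symbols of positive probability. -/
def image (W : DMC X Y) : Finset Y := Finset.univ.filter fun y => 0 < outputProb W y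

theorem outputProb_nonneg (W : DMC X Y) (y : Y) : 0 ≤ outputProb W y :=
  mul_nonneg (by positivity) (Finset.sum_nonneg fun _ _ => stdSimplex.zero_le _ _)

/-- Sums of a positively homogeneous function over the columns of a channel are invariant under
equivalence. -/
theorem IsEquivalent.sum_eq {W : DMC X Y} {W' : DMC X Z} (h : IsEquivalent W W')
    (G : (X → ℝ) → ℝ) (hG : ∀ (c : ℝ) (w : X → ℝ), 0 ≤ c → G (c • w) = c * G w) :
    ∑ z, G (fun x => W' x z) = ∑ y, G (fun x => W x y) := by
  obtain ⟨⟨V, hV⟩, ⟨V', hV'⟩⟩ := h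
  let c : Y → EuclideanSpace ℝ X := fun y => WithLp.toLp 2 fun x => W x y
  let c' : Z → EuclideanSpace ℝ X := fun z => WithLp.toLp 2 fun x => W' x z
  have hc' : ∀ z, c' z = ∑ y, V y z • c y := by
    intro z
    ext x
    simp [c, c', hV]
  have hc : ∀ y, c y = ∑ z, V' z y • c' z := by
    intro y
    ext x
    have := congrArg (fun U : DMC X Y => U x y) hV'
    simpa [c, c'] using this
  have key1 : ∀ z, ‖c' z‖ ≤ ∑ y, ‖V y z • c y‖ := fun z => by
    rw [hc' z]; exact norm_sum_le _ _
  have key2 : ∀ y, ‖c y‖ ≤ ∑ z, ‖V' z y • c' z‖ := fun y => by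
    conv_lhs => rw [hc y]
    exact norm_sum_le _ _
  have tot1 : ∑ z, ∑ y, ‖V y z • c y‖ = ∑ y, ‖c y‖ := by
    rw [Finset.sum_comm]
    refine Finset.sum_congr rfl fun y _ => ?_
    simp [norm_smul, abs_of_nonneg, ← Finset.sum_mul]
  have tot2 : ∑ y, ∑ z, ‖V' z y • c' z‖ = ∑ z, ‖c' z‖ := by
    rw [Finset.sum_comm]
    refine Finset.sum_congr rfl fun z _ => ?_
    simp [norm_smul, abs_of_nonneg, ← Finset.sum_mul]
  have hle : ∑ z, ∑ y, ‖V y z • c y‖ ≤ ∑ z, ‖c' z‖ := by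
    rw [tot1, ← tot2]
    exact Finset.sum_le_sum fun y _ => key2 y
  have heq : ∀ z, ‖c' z‖ = ∑ y, ‖V y z • c y‖ := by
    have := (Finset.sum_eq_sum_iff_of_le fun z _ => key1 z).1
      (le_antisymm (Finset.sum_le_sum fun z _ => key1 z) hle)
    exact fun z => this z (Finset.mem_univ z)
  have hray : ∀ z y, ‖V y z • c y‖ • c' z = ‖c' z‖ • (V y z • c y) := by
    classical
    intro z y
    have hs : c' z = V y z • c y + ∑ y' ∈ Finset.univ.erase y, V y' z • c y' := by
      rw [hc' z, Finset.add_sum_erase _ (fun y' => V y' z • c y') (Finset.mem_univ y)]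
    have hn : ‖c' z‖ = ‖V y z • c y‖ + ‖∑ y' ∈ Finset.univ.erase y, V y' z • c y'‖ := by
      refine le_antisymm (by conv_lhs => rw [hs]
                             exact norm_add_le _ _) ?_
      rw [heq z, ← Finset.add_sum_erase _ (fun y' => ‖V y' z • c y'‖) (Finset.mem_univ y)]
      gcongr
      exact norm_sum_le _ _
    have hr : SameRay ℝ (V y z • c y) (∑ y' ∈ Finset.univ.erase y, V y' z • c y') := by
      rw [sameRay_iff_norm_add, ← hn, ← hs]
    have hr' : SameRay ℝ (V y z • c y) (c' z) := by
      rw [hs]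
      exact SameRay.add_right SameRay.rfl hr
    exact hr'.norm_smul_eq
  have hG' : ∀ (a : ℝ) (w : EuclideanSpace ℝ X), 0 ≤ a → G (a • w).ofLp = a * G w.ofLp :=
    fun a w ha => hG a w.ofLp ha
  have hG0 : G (0 : EuclideanSpace ℝ X).ofLp = 0 := by
    have := hG' 0 0 le_rfl
    simpa using this
  have hsplit : ∀ z, G (c' z).ofLp = ∑ y, G (V y z • c y).ofLp := by
    intro z
    by_cases h0 : ‖c' z‖ = 0
    · have h1 : ∀ y, V y z • c y = 0 := by
        have h2 := heq z
        rw [h0] at h2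
        intro y
        exact norm_eq_zero.1 ((Finset.sum_eq_zero_iff_of_nonneg
          (fun y _ => norm_nonneg _)).1 h2.symm y (Finset.mem_univ y))
      rw [norm_eq_zero.1 h0, hG0]
      exact (Finset.sum_eq_zero fun y _ => by rw [h1 y, hG0]).symm
    · have h1 : ∀ y, ‖c' z‖ * G (V y z • c y).ofLp = ‖V y z • c y‖ * G (c' z).ofLp := by
        intro y
        rw [← hG' _ _ (norm_nonneg _), ← hG' _ _ (norm_nonneg _), hray z y]
      have h2 : ‖c' z‖ * ∑ y, G (V y z • c y).ofLp = ‖c' z‖ * G (c' z).ofLp := by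
        rw [Finset.mul_sum, Finset.sum_congr rfl fun y _ => h1 y, ← Finset.sum_mul, ← heq z]
      exact (mul_left_cancel₀ h0 h2).symm
  calc ∑ z, G (fun x => W' x z) = ∑ z, ∑ y, G (V y z • c y).ofLp :=
        Finset.sum_congr rfl fun z _ => hsplit z
    _ = ∑ y, ∑ z, V y z * G (c y).ofLp := by
        rw [Finset.sum_comm]
        exact Finset.sum_congr rfl fun y _ => Finset.sum_congr rfl fun z _ =>
          hG' _ _ (stdSimplex.zero_le _ _)
    _ = ∑ y, G (fun x => W x y) := by
        refine Finset.sum_congr rfl fun y _ => ?_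
        rw [← Finset.sum_mul, stdSimplex.sum_eq_one, one_mul]

/-- The contribution of a column of a channel to the Blackwell mass of `B`. -/
def columnMass (B : Set (stdSimplex ℝ X)) (w : X → ℝ) : ℝ :=
  ((Fintype.card X : ℝ)⁻¹ * ∑ x, w x) * (Subtype.val '' B).indicator 1 ((∑ x, w x)⁻¹ • w)

theorem columnMass_smul (B : Set (stdSimplex ℝ X)) (c : ℝ) (w : X → ℝ) (hc0 : 0 ≤ c) :
    columnMass B (c • w) = c * columnMass B w := by
  rcases hc0.eq_or_lt with rfl | hpos
  · simp [columnMass]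
  · have h1 : ∑ x, (c • w) x = c * ∑ x, w x := by simp [Finset.mul_sum]
    have h2 : (c * ∑ x, w x)⁻¹ • (c • w) = (∑ x, w x)⁻¹ • w := by
      rw [smul_smul, mul_inv]
      congr 1
      field_simp
    simp only [columnMass, h1, h2]
    ring

variable [Nonempty X]

theorem card_pos : (0 : ℝ) < Fintype.card X := by exact_mod_cast Fintype.card_pos

/-- `W_y⁻¹(x) = W(y|x) / (|X| P_W^o(y))`: the posterior distribution on `X` given the output
`y ∈ Im(W)`. For `y ∉ Im(W)` it is set to the uniform distribution, which is never used. -/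
def posterior (W : DMC X Y) (y : Y) : stdSimplex ℝ X :=
  if h : 0 < outputProb W y then
    ⟨fun x => W x y / (Fintype.card X * outputProb W y),
      fun x => div_nonneg (stdSimplex.zero_le _ _) (mul_nonneg (by positivity) h.le), by
        have hc : (Fintype.card X : ℝ) ≠ 0 := card_pos.ne'
        rw [← Finset.sum_div, div_eq_one_iff_eq (mul_ne_zero hc h.ne'), outputProb,
          mul_inv_cancel_left₀ hc]⟩
  else stdSimplex.barycenter

/-- The Blackwell measure of `W`: the measure on the simplex of probability distributions on `X`
with mass `P_W^o(y)` at `W_y⁻¹` for each `y ∈ Im(W)`. -/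
def blackwellMeasure (W : DMC X Y) : Measure (stdSimplex ℝ X) :=
  ∑ y ∈ image W, ENNReal.ofReal (outputProb W y) • Measure.dirac (posterior W y)

theorem outputProb_mul_posterior (W : DMC X Y) (y : Y) (x : X) :
    outputProb W y * posterior W y x = (Fintype.card X : ℝ)⁻¹ * W x y := by
  have hc : (Fintype.card X : ℝ) ≠ 0 := card_pos.ne'
  by_cases h : 0 < outputProb W y
  · have : posterior W y x = W x y / (Fintype.card X * outputProb W y) := by
      rw [posterior, dif_pos h]; rfl
    rw [this]
    field_simp
  · have h0 : outputProb W y = 0 := le_antisymm (not_lt.1 h) (outputProb_nonneg W y)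
    have h1 : ∑ x, W x y = 0 := by
      rcases mul_eq_zero.1 h0 with h2 | h2
      · exact absurd h2 (inv_ne_zero hc)
      · exact h2
    have h2 := (Finset.sum_eq_zero_iff_of_nonneg
      (fun x _ => stdSimplex.zero_le (W x) y)).1 h1 x (Finset.mem_univ x)
    rw [h0, h2, zero_mul, mul_zero]

theorem sum_outputProb (W : DMC X Y) : ∑ y, outputProb W y = 1 := by
  have hc : (Fintype.card X : ℝ) ≠ 0 := card_pos.ne'
  simp only [outputProb]
  rw [← Finset.mul_sum, Finset.sum_comm]
  simp [hc]

theorem blackwellMeasure_eq (W : DMC X Y) : blackwellMeasure W =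
    ∑ y, ENNReal.ofReal (outputProb W y) • Measure.dirac (posterior W y) := by
  refine Finset.sum_subset (Finset.subset_univ _) fun y _ hy => ?_
  have : outputProb W y ≤ 0 := by simpa [image] using hy
  rw [ENNReal.ofReal_of_nonpos this, zero_smul]

theorem blackwellMeasure_apply (W : DMC X Y) {B : Set (stdSimplex ℝ X)} (hB : MeasurableSet B) :
    blackwellMeasure W B =
      ENNReal.ofReal (∑ y, outputProb W y * B.indicator 1 (posterior W y)) := by
  rw [blackwellMeasure_eq, ENNReal.ofReal_sum_of_nonneg]
  · simp only [Measure.coe_finsetSum, Finset.sum_apply, Measure.smul_apply, smul_eq_mul]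
    refine Finset.sum_congr rfl fun y _ => ?_
    rw [Measure.dirac_apply' _ hB]
    by_cases h : posterior W y ∈ B <;> simp [h]
  · intro y _
    exact mul_nonneg (outputProb_nonneg W y) (Set.indicator_nonneg (fun _ _ => zero_le_one) _)

theorem columnMass_column (B : Set (stdSimplex ℝ X)) (W : DMC X Y) (y : Y) :
    columnMass B (fun x => W x y) = outputProb W y * B.indicator 1 (posterior W y) := by
  have hc : (Fintype.card X : ℝ) ≠ 0 := card_pos.ne'
  have h1 : outputProb W y = (Fintype.card X : ℝ)⁻¹ * ∑ x, W x y := rfl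
  simp only [columnMass]
  by_cases h0 : outputProb W y = 0
  · rw [← h1, h0, zero_mul, zero_mul]
  · have h2 : (∑ x, W x y)⁻¹ • (fun x => W x y) = (posterior W y).val := by
      funext x
      have h3 := outputProb_mul_posterior W y x
      have h4 : ∑ x, W x y = Fintype.card X * outputProb W y := by
        rw [h1, mul_inv_cancel_left₀ hc]
      have h5 : (posterior W y).val x = posterior W y x := rfl
      rw [h5, Pi.smul_apply, smul_eq_mul, h4, mul_inv, mul_right_comm, ← h3]
      field_simp
    rw [← h1, h2]
    congr 1
    by_cases hm : posterior W y ∈ B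
    · rw [Set.indicator_of_mem hm, Set.indicator_of_mem (Set.mem_image_of_mem _ hm)]
      rfl
    · rw [Set.indicator_of_notMem hm, Set.indicator_of_notMem]
      rwa [Subtype.val_injective.mem_set_image]

/-- Equivalent channels have the same Blackwell measure. -/
theorem IsEquivalent.blackwellMeasure_eq {W : DMC X Y} {W' : DMC X Z} (h : IsEquivalent W W') :
    blackwellMeasure W = blackwellMeasure W' := by
  ext B hB
  rw [blackwellMeasure_apply W hB, blackwellMeasure_apply W' hB]
  simp only [← columnMass_column]
  rw [h.sum_eq (columnMass B) (columnMass_smul B)]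

theorem isDegradedFrom_of_blackwellMeasure_eq {W : DMC X Y} {W' : DMC X Z}
    (h : blackwellMeasure W = blackwellMeasure W') : IsDegradedFrom W' W := by
  classical
  have hc : (Fintype.card X : ℝ) ≠ 0 := card_pos.ne'
  let M : stdSimplex ℝ X → ℝ := fun q =>
    ∑ y, outputProb W y * if posterior W y = q then 1 else 0
  have hM : ∀ q, M q = ∑ z, outputProb W' z * if posterior W' z = q then 1 else 0 := by
    intro q
    have h1 := congrArg (fun μ => μ {q}) h
    simp only [blackwellMeasure_apply W (measurableSet_singleton q),
      blackwellMeasure_apply W' (measurableSet_singleton q), Set.indicator_apply,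
      Set.mem_singleton_iff, Pi.one_apply] at h1
    refine (ENNReal.ofReal_eq_ofReal_iff ?_ ?_).1 h1 <;>
    exact Finset.sum_nonneg fun _ _ => mul_nonneg (outputProb_nonneg _ _) (by split_ifs <;> simp)
  have hle : ∀ y, outputProb W y ≤ M (posterior W y) := by
    intro y
    have := Finset.single_le_sum (f := fun y' => outputProb W y' *
      if posterior W y' = posterior W y then (1 : ℝ) else 0)
      (fun _ _ => mul_nonneg (outputProb_nonneg _ _) (by split_ifs <;> simp)) (Finset.mem_univ y)
    simpa [M] using this
  have hle' : ∀ z, outputProb W' z ≤ M (posterior W' z) := by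
    intro z
    rw [hM]
    have := Finset.single_le_sum (f := fun z' => outputProb W' z' *
      if posterior W' z' = posterior W' z then (1 : ℝ) else 0)
      (fun _ _ => mul_nonneg (outputProb_nonneg _ _) (by split_ifs <;> simp)) (Finset.mem_univ z)
    simpa using this
  have hM0 : ∀ q, 0 ≤ M q := fun q =>
    Finset.sum_nonneg fun _ _ => mul_nonneg (outputProb_nonneg _ _) (by split_ifs <;> simp)
  have hV : ∀ y, ∃ v : stdSimplex ℝ Z, 0 < outputProb W y → ∀ z, v z =
      outputProb W' z * (if posterior W' z = posterior W y then 1 else 0) / M (posterior W y) := by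
    intro y
    by_cases hy : 0 < outputProb W y
    · refine ⟨⟨fun z => outputProb W' z * (if posterior W' z = posterior W y then 1 else 0) /
        M (posterior W y), fun z => ?_, ?_⟩, fun _ z => rfl⟩
      · exact div_nonneg (mul_nonneg (outputProb_nonneg _ _) (by split_ifs <;> simp)) (hM0 _)
      · rw [← Finset.sum_div, ← hM, div_self (hy.trans_le (hle y)).ne']
    · exact ⟨W' (Classical.arbitrary X), fun h' => absurd h' hy⟩
  choose V hV using hV
  refine ⟨V, ?_⟩
  funext x
  refine DFunLike.ext _ _ fun z => ?_
  have hW : ∀ y, W x y = Fintype.card X * (outputProb W y * posterior W y x) := fun y => by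
    rw [outputProb_mul_posterior, mul_inv_cancel_left₀ hc]
  have hW' : W' x z = Fintype.card X * (outputProb W' z * posterior W' z x) := by
    rw [outputProb_mul_posterior, mul_inv_cancel_left₀ hc]
  have hterm : ∀ y, V y z * W x y =
      Fintype.card X * (outputProb W' z * posterior W' z x / M (posterior W' z)) *
        (outputProb W y * if posterior W y = posterior W' z then 1 else 0) := by
    intro y
    rw [hW]
    rcases (outputProb_nonneg W y).eq_or_lt with h0 | h0
    · rw [← h0]; ring
    · rw [hV y h0]
      by_cases he : posterior W' z = posterior W y
      · rw [if_pos he, if_pos he.symm, he]; ring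
      · rw [if_neg he, if_neg (Ne.symm he)]; ring
  have hs : ∑ y, V y z * W x y =
      Fintype.card X * (outputProb W' z * posterior W' z x / M (posterior W' z)) *
        M (posterior W' z) := by
    rw [Finset.mul_sum]
    exact Finset.sum_congr rfl fun y _ => hterm y
  rw [comp_apply, hs, hW']
  rcases (outputProb_nonneg W' z).eq_or_lt with h0 | h0
  · rw [← h0]; ring
  · have := (h0.trans_le (hle' z)).ne'
    field_simp

/-- Two channels are equivalent if and only if they have the same Blackwell measure. -/
theorem isEquivalent_iff_blackwellMeasure_eq {W : DMC X Y} {W' : DMC X Z} :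
    IsEquivalent W W' ↔ blackwellMeasure W = blackwellMeasure W' :=
  ⟨fun h => h.blackwellMeasure_eq, fun h => ⟨isDegradedFrom_of_blackwellMeasure_eq h,
    isDegradedFrom_of_blackwellMeasure_eq h.symm⟩⟩

theorem isProbabilityMeasure_blackwellMeasure (W : DMC X Y) :
    IsProbabilityMeasure (blackwellMeasure W) := by
  constructor
  rw [blackwellMeasure_apply W MeasurableSet.univ]
  simp [sum_outputProb]

theorem integral_blackwellMeasure (W : DMC X Y) (x : X) :
    ∫ p, p x ∂(blackwellMeasure W) = (Fintype.card X : ℝ)⁻¹ := by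
  rw [blackwellMeasure_eq, integral_finsetSum_measure]
  · simp only [integral_smul_measure, integral_dirac, smul_eq_mul,
      ENNReal.toReal_ofReal (outputProb_nonneg W _), outputProb_mul_posterior]
    rw [← Finset.mul_sum, stdSimplex.sum_eq_one, mul_one]
  · intro y _
    exact (integrable_dirac (by simp)).smul_measure ENNReal.ofReal_ne_top

theorem finite_support_blackwellMeasure (W : DMC X Y) : (blackwellMeasure W).support.Finite := by
  have hf : (Set.range (posterior W)).Finite := Set.finite_range _
  refine hf.subset (Measure.support_subset_of_isClosed hf.isClosed ?_)
  rw [mem_ae_iff, blackwellMeasure_apply W hf.isClosed.measurableSet.compl]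
  simp

end Blackwell

/-- The set of balanced and finitely supported meta-probability measures on `X`: Borel probability
measures `μ` on the simplex whose barycenter is the uniform distribution on `X` and whose
support is finite. It carries the weak-* topology as a subspace of the space of probability
measures. -/
abbrev MPbf (X : Type*) [Fintype X] : Type _ :=
  {μ : ProbabilityMeasure (stdSimplex ℝ X) //
    (∀ x, ∫ p, p x ∂(μ : Measure (stdSimplex ℝ X)) = (Fintype.card X : ℝ)⁻¹) ∧
    (μ : Measure (stdSimplex ℝ X)).support.Finite}

section CanonicalBijection

variable (X : Type*) [Fintype X] [Nonempty X]

/-- The map `Ŵ ↦ MP_Ŵ`, where `MP_Ŵ := MP_W` for any `W ∈ Ŵ`. -/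
def EquivDMC.blackwell (w : EquivDMC X) : MPbf X :=
  Quotient.lift (fun W : AllDMC X => (⟨⟨blackwellMeasure W.2,
      isProbabilityMeasure_blackwellMeasure W.2⟩, integral_blackwellMeasure W.2,
      finite_support_blackwellMeasure W.2⟩ : MPbf X))
    (fun W W' (h : IsEquivalent W.2 W'.2) =>
      Subtype.ext (Subtype.ext h.blackwellMeasure_eq)) w

theorem EquivDMC.blackwell_injective : Function.Injective (EquivDMC.blackwell X) := by
  intro w w'
  induction w using Quotient.inductionOn with
  | h W =>
  induction w' using Quotient.inductionOn with
  | h W' =>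
  intro h
  have h' : blackwellMeasure W.2 = blackwellMeasure W'.2 :=
    congrArg (fun μ : MPbf X => (μ.1 : Measure (stdSimplex ℝ X))) h
  exact Quotient.sound (isEquivalent_iff_blackwellMeasure_eq.2 h')

theorem EquivDMC.blackwell_surjective : Function.Surjective (EquivDMC.blackwell X) := by
  classical
  rintro ⟨⟨μ, hμ⟩, hbal, hfin⟩
  replace hbal : ∀ x, ∫ p, p x ∂μ = (Fintype.card X : ℝ)⁻¹ := hbal
  replace hfin : μ.support.Finite := hfin
  have hc : (Fintype.card X : ℝ) ≠ 0 := card_pos.ne'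
  have hne : μ.support.Nonempty := Measure.nonempty_support hμ.ne_zero
  have : Fintype μ.support := hfin.fintype
  have : Nonempty μ.support := hne.to_subtype
  let e : μ.support ≃ Fin (Fintype.card μ.support) := Fintype.equivFin _
  let n : ℕ+ := ⟨Fintype.card μ.support, Fintype.card_pos⟩
  let q : Fin n → stdSimplex ℝ X := fun i => (e.symm i).1
  have hq : Function.Injective q := fun i j h => e.symm.injective (Subtype.ext h)
  have hrange : Set.range q = μ.support := by
    ext p
    constructor
    · rintro ⟨i, rfl⟩; exact (e.symm i).2
    · exact fun hp => ⟨e ⟨p, hp⟩, by simp [q]⟩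
  have hμq : μ = ∑ i, μ {q i} • Measure.dirac (q i) := by
    ext B hB
    have h1 : μ B = μ (⋃ i ∈ Finset.univ.filter (fun i => q i ∈ B), {q i}) := by
      refine measure_congr ?_
      have hae : ∀ᵐ p ∂μ, p ∈ μ.support := Measure.support_mem_ae
      filter_upwards [hae] with p hp
      rw [← hrange] at hp
      obtain ⟨i, rfl⟩ := hp
      refine propext ⟨fun hp => ?_, fun hp => ?_⟩
      · change q i ∈ ⋃ i ∈ Finset.univ.filter (fun i => q i ∈ B), {q i}
        have : q i ∈ B := hp
        simp only [Set.mem_iUnion, Finset.mem_filter, Finset.mem_univ, true_and]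
        exact ⟨i, this, rfl⟩
      · have hp' : q i ∈ ⋃ i ∈ Finset.univ.filter (fun i => q i ∈ B), {q i} := hp
        simp only [Set.mem_iUnion, Finset.mem_filter, Finset.mem_univ, true_and] at hp'
        obtain ⟨j, hj, hij⟩ := hp'
        have hij' : q i = q j := hij
        change q i ∈ B
        rwa [hij']
    rw [h1, measure_biUnion_finset]
    · simp only [Measure.coe_finsetSum, Finset.sum_apply, Measure.smul_apply, smul_eq_mul,
        Finset.sum_filter]
      refine Finset.sum_congr rfl fun i _ => ?_
      rw [Measure.dirac_apply' _ hB]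
      by_cases h : q i ∈ B <;> simp [h]
    · intro i _ j _ hij
      exact Set.disjoint_singleton.2 (hq.ne hij)
    · exact fun i _ => measurableSet_singleton _
  have hint : ∀ x, ∑ i, μ.real {q i} * q i x = (Fintype.card X : ℝ)⁻¹ := by
    intro x
    rw [← hbal x]
    conv_rhs => rw [hμq]
    rw [integral_finsetSum_measure]
    · simp only [integral_smul_measure, integral_dirac, smul_eq_mul, Measure.real]
    · intro i _
      exact (integrable_dirac (by simp)).smul_measure (measure_ne_top _ _)
  let W : DMC X (Fin n) := fun x => ⟨fun i => Fintype.card X * (μ.real {q i} * q i x),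
    fun i => mul_nonneg (by positivity)
      (mul_nonneg measureReal_nonneg (stdSimplex.zero_le _ _)),
    by rw [← Finset.mul_sum, hint, mul_inv_cancel₀ hc]⟩
  have hW : ∀ x i, W x i = Fintype.card X * (μ.real {q i} * q i x) := fun _ _ => rfl
  have hout : ∀ i, outputProb W i = μ.real {q i} := by
    intro i
    simp only [outputProb, hW]
    rw [← Finset.mul_sum, ← Finset.mul_sum, stdSimplex.sum_eq_one, mul_one,
      inv_mul_cancel_left₀ hc]
  refine ⟨Quotient.mk _ ⟨n, W⟩, Subtype.ext (Subtype.ext ?_)⟩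
  change blackwellMeasure W = μ
  refine Eq.trans ?_ hμq.symm
  rw [blackwellMeasure_eq]
  refine Finset.sum_congr rfl fun i _ => ?_
  rw [hout, ofReal_measureReal]
  by_cases h0 : μ.real {q i} = 0
  · rw [(measureReal_eq_zero_iff).1 h0, zero_smul, zero_smul]
  · congr 2
    refine DFunLike.ext _ _ fun x => ?_
    have h1 := outputProb_mul_posterior W i x
    rw [hout, hW, inv_mul_cancel_left₀ hc] at h1
    exact mul_left_cancel₀ h0 h1

/-- The canonical bijection `F_can` from the balanced finitely supported meta-probability measures
onto the space of equivalent channels: the inverse of `Ŵ ↦ MP_Ŵ`. -/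
def canonicalBijection : MPbf X ≃ EquivDMC X :=
  (Equiv.ofBijective (EquivDMC.blackwell X)
    ⟨EquivDMC.blackwell_injective X, EquivDMC.blackwell_surjective X⟩).symm

/-- The weak-* topology on `EquivDMC X`: a set `U` is open if and only if `F_can⁻¹(U)` is
weakly-* open in `MPbf X`. -/
abbrev weakStarTopology : TopologicalSpace (EquivDMC X) :=
  TopologicalSpace.coinduced (canonicalBijection X)
    (inferInstance : TopologicalSpace (MPbf X))

end CanonicalBijection

end DMCSpace

/-! Both topologies are governed by integrals against the Blackwell measure. An optimal decoder
picks, for each output `y`, a `u` maximising `∑ x, p(u,x) W(y|x)`. This maximum is positively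
homogeneous in the column `W(y|·) = |X| P_W^o(y) W_y⁻¹`, so `P_c(p, W) = |X| ∫ φ_p dMP_W` with
`φ_p(q) = max_u ∑ x, p(u,x) q(x)` (`EquivDMC.probCorrect_eq_integral`). Noisiness convergence is
thus convergence of `∫ φ_p` uniformly in `p`, and weak-* convergence is convergence of `∫ f` for
each continuous `f`.

Weak-* neighbourhoods are fine enough for the noisiness distance because the `φ_p`, over all `m` and
`p`, take values in `[0,1]` and are 1-Lipschitz. By Arzelà–Ascoli they form a totally bounded family
(`totallyBounded_maxLinearMap_jointRows`), so finitely many integrals control all of them.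

Conversely, every maximum of linear functionals on the simplex is an affine function of some `φ_p`
(`exists_maxLinearMap_eq`), so the noisiness topology makes its integral continuous. Differences of
such maxima form a lattice that interpolates values at any two points, hence are uniformly dense by
the lattice form of Stone–Weierstrass (`closure_maxLinearDifferences`). Integration against
probability measures is 1-Lipschitz in the integrand, so continuity passes to every continuous `f`.
-/

namespace DMCSpace

/-! ### Maxima of finitely many linear functionals -/

section MaxLinear

variable {X ι κ : Type*} [Fintype X] [Finite ι] [Nonempty ι] [Finite κ] [Nonempty κ]

/-- The maximum of the linear functionals with coefficient vectors `a i`. -/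
def maxLinear {X ι : Type*} [Fintype X] (a : ι → X → ℝ) (q : X → ℝ) : ℝ :=
  ⨆ i, ∑ x, a i x * q x

theorem le_maxLinear {X ι : Type*} [Fintype X] [Finite ι] (a : ι → X → ℝ) (q : X → ℝ) (i : ι) :
    ∑ x, a i x * q x ≤ maxLinear a q :=
  le_ciSup (f := fun i => ∑ x, a i x * q x) (Set.finite_range _).bddAbove i

theorem exists_eq_maxLinear (a : ι → X → ℝ) (q : X → ℝ) :
    ∃ i, ∑ x, a i x * q x = maxLinear a q :=
  exists_eq_ciSup_of_finite

theorem maxLinear_smul {X ι : Type*} [Fintype X] (a : ι → X → ℝ) {c : ℝ} (hc : 0 ≤ c)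
    (q : X → ℝ) : maxLinear a (fun x => c * q x) = c * maxLinear a q := by
  simp only [maxLinear, Real.mul_iSup_of_nonneg hc, Finset.mul_sum, mul_left_comm]

theorem smul_maxLinear {X ι : Type*} [Fintype X] (a : ι → X → ℝ) {c : ℝ} (hc : 0 ≤ c)
    (q : X → ℝ) : maxLinear (fun i x => c * a i x) q = c * maxLinear a q := by
  simp only [maxLinear, Real.mul_iSup_of_nonneg hc, Finset.mul_sum, mul_assoc]

/-- The indices `i` and `j` are chosen independently, so a sum of two maxima is one maximum over
pairs. -/
theorem maxLinear_add (a : ι → X → ℝ) (b : κ → X → ℝ) (q : X → ℝ) :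
    maxLinear (fun (i : ι × κ) x => a i.1 x + b i.2 x) q = maxLinear a q + maxLinear b q := by
  refine le_antisymm (ciSup_le fun i => ?_) ?_
  · simp only [add_mul, Finset.sum_add_distrib]
    exact add_le_add (le_maxLinear a q _) (le_maxLinear b q _)
  · obtain ⟨i, hi⟩ := exists_eq_maxLinear a q
    obtain ⟨j, hj⟩ := exists_eq_maxLinear b q
    rw [← hi, ← hj, ← Finset.sum_add_distrib]
    refine le_trans (le_of_eq ?_) (le_maxLinear _ q (i, j))
    simp only [add_mul]

theorem maxLinear_sup (a : ι → X → ℝ) (b : κ → X → ℝ) (q : X → ℝ) :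
    maxLinear (Sum.elim a b) q = maxLinear a q ⊔ maxLinear b q := by
  refine le_antisymm (ciSup_le ?_) (sup_le (ciSup_le fun i => ?_) (ciSup_le fun j => ?_))
  · rintro (i | j)
    · exact le_sup_of_le_left (le_maxLinear a q i)
    · exact le_sup_of_le_right (le_maxLinear b q j)
  · exact le_maxLinear (Sum.elim a b) q (Sum.inl i)
  · exact le_maxLinear (Sum.elim a b) q (Sum.inr j)

theorem maxLinear_comp_equiv {X ι κ : Type*} [Fintype X] (e : κ ≃ ι) (a : ι → X → ℝ) (q : X → ℝ) :
    maxLinear (fun k => a (e k)) q = maxLinear a q :=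
  e.iSup_comp (g := fun i => ∑ x, a i x * q x)

/-- On the simplex the coordinates sum to 1, so constants are themselves linear functionals. -/
theorem maxLinear_add_const (a : ι → X → ℝ) (c : ℝ) (q : stdSimplex ℝ X) :
    maxLinear (fun i x => a i x + c) q = maxLinear a q + c := by
  have h : ∀ i, ∑ x, (a i x + c) * q x = ∑ x, a i x * q x + c := fun i => by
    simp only [add_mul, Finset.sum_add_distrib, ← Finset.mul_sum, stdSimplex.sum_eq_one, mul_one]
  refine le_antisymm (ciSup_le fun i => ?_) ?_
  · rw [h]
    exact add_le_add_left (le_maxLinear a q i) c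
  · obtain ⟨i, hi⟩ := exists_eq_maxLinear a q
    rw [← hi, ← h]
    exact le_maxLinear (fun i x => a i x + c) q i

theorem continuous_maxLinear (a : ι → X → ℝ) : Continuous (maxLinear a) := by
  have := Fintype.ofFinite ι
  have h : maxLinear a =
      fun q => Finset.univ.sup' Finset.univ_nonempty fun i => ∑ x, a i x * q x := by
    funext q
    rw [Finset.sup'_univ_eq_ciSup, maxLinear]
  rw [h]
  exact Continuous.finset_sup'_apply _ fun i _ => by fun_prop

/-- `maxLinear a` as a continuous function on the simplex. -/
def maxLinearMap (a : ι → X → ℝ) : C(stdSimplex ℝ X, ℝ) :=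
  ⟨fun q => maxLinear a q, (continuous_maxLinear a).comp continuous_subtype_val⟩

@[simp]
theorem maxLinearMap_apply (a : ι → X → ℝ) (q : stdSimplex ℝ X) :
    maxLinearMap a q = maxLinear a q := rfl

/-- The vector lattice of differences of maxima of linear functionals on the simplex. -/
def maxLinearDifferences (X : Type*) [Fintype X] : Set C(stdSimplex ℝ X, ℝ) :=
  {f | ∃ (m n : ℕ+) (a : Fin m → X → ℝ) (b : Fin n → X → ℝ),
    f = maxLinearMap a - maxLinearMap b}

/-- Frees the index types from `Fin`, so that the products and sums of index types arising below
need no explicit enumeration. -/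
theorem maxLinearMap_sub_mem (a : ι → X → ℝ) (b : κ → X → ℝ) :
    maxLinearMap a - maxLinearMap b ∈ maxLinearDifferences X := by
  have := Fintype.ofFinite ι
  have := Fintype.ofFinite κ
  refine ⟨⟨Fintype.card ι, Fintype.card_pos⟩, ⟨Fintype.card κ, Fintype.card_pos⟩,
    fun i => a ((Fintype.equivFin ι).symm i), fun j => b ((Fintype.equivFin κ).symm j), ?_⟩
  ext q
  exact congrArg₂ (· - ·) (maxLinear_comp_equiv (Fintype.equivFin ι).symm a q).symm
    (maxLinear_comp_equiv (Fintype.equivFin κ).symm b q).symm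

theorem neg_mem_maxLinearDifferences {f : C(stdSimplex ℝ X, ℝ)}
    (hf : f ∈ maxLinearDifferences X) : -f ∈ maxLinearDifferences X := by
  obtain ⟨m, n, a, b, rfl⟩ := hf
  exact ⟨n, m, b, a, neg_sub _ _⟩

theorem sup_mem_maxLinearDifferences {f g : C(stdSimplex ℝ X, ℝ)}
    (hf : f ∈ maxLinearDifferences X) (hg : g ∈ maxLinearDifferences X) :
    f ⊔ g ∈ maxLinearDifferences X := by
  obtain ⟨m, n, a, b, rfl⟩ := hf
  obtain ⟨m', n', a', b', rfl⟩ := hg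
  -- With `A, B, A', B'` the four maxima: `(A - B) ⊔ (A' - B') = ((A + B') ⊔ (A' + B)) - (B + B')`.
  have h : (maxLinearMap a - maxLinearMap b) ⊔ (maxLinearMap a' - maxLinearMap b') =
      maxLinearMap (Sum.elim (fun (i : Fin m × Fin n') x => a i.1 x + b' i.2 x)
        fun (i : Fin m' × Fin n) x => a' i.1 x + b i.2 x) -
      maxLinearMap fun (i : Fin n × Fin n') x => b i.1 x + b' i.2 x := by
    ext q
    simp only [ContinuousMap.sup_apply, ContinuousMap.sub_apply, maxLinearMap_apply, maxLinear_sup,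
      maxLinear_add]
    rw [← max_sub_sub_right]
    congr 1 <;> ring
  rw [h]
  exact maxLinearMap_sub_mem _ _

theorem inf_mem_maxLinearDifferences {f g : C(stdSimplex ℝ X, ℝ)}
    (hf : f ∈ maxLinearDifferences X) (hg : g ∈ maxLinearDifferences X) :
    f ⊓ g ∈ maxLinearDifferences X := by
  have h := neg_mem_maxLinearDifferences (sup_mem_maxLinearDifferences
    (neg_mem_maxLinearDifferences hf) (neg_mem_maxLinearDifferences hg))
  rwa [neg_sup, neg_neg, neg_neg] at h

theorem linear_mem_maxLinearDifferences (v : X → ℝ) :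
    (⟨fun q => ∑ x, v x * q x, continuous_finsetSum _ fun x _ =>
      continuous_const.mul ((continuous_apply x).comp continuous_subtype_val)⟩ : C(stdSimplex ℝ X, ℝ)) ∈
      maxLinearDifferences X := by
  convert maxLinearMap_sub_mem (fun _ : Unit => v) (fun _ : Unit => (0 : X → ℝ)) using 1
  ext q
  simp [maxLinear]

/-- Linear functionals already suffice: on the simplex they include all affine functions of one
coordinate, and two distinct points differ in some coordinate. -/
theorem separatesPointsStrongly_maxLinearDifferences :
    (maxLinearDifferences X).SeparatesPointsStrongly := by
  intro f p q
  by_cases h : p = q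
  · subst h
    refine ⟨_, linear_mem_maxLinearDifferences fun _ => f p, ?_⟩
    simp [← Finset.mul_sum]
  · obtain ⟨x, hx⟩ : ∃ x, p x ≠ q x := by
      by_contra! hpq
      exact h (DFunLike.ext _ _ hpq)
    classical
    have hd : p x - q x ≠ 0 := sub_ne_zero.2 hx
    -- The affine function of the coordinate `x` passing through the values `f p` and `f q`; its
    -- constant term is spread over all coefficients.
    have key : ∀ r : stdSimplex ℝ X, ∑ y, ((f p - f q) / (p x - q x) *
        (Pi.single x 1 : X → ℝ) y + (f q - (f p - f q) / (p x - q x) * q x)) * r y =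
        (f p - f q) / (p x - q x) * r x + (f q - (f p - f q) / (p x - q x) * q x) := by
      intro r
      simp only [add_mul, Finset.sum_add_distrib, mul_assoc, ← Finset.mul_sum,
        stdSimplex.sum_eq_one, mul_one]
      simp [Pi.single_apply]
    refine ⟨_, linear_mem_maxLinearDifferences fun y => (f p - f q) / (p x - q x) *
        (Pi.single x 1 : X → ℝ) y + (f q - (f p - f q) / (p x - q x) * q x), ?_, ?_⟩
    · refine (key p).trans ?_
      field_simp
      ring
    · refine (key q).trans ?_
      ring

theorem closure_maxLinearDifferences : closure (maxLinearDifferences X) = ⊤ :=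
  ContinuousMap.sublattice_closure_eq_top _ ⟨_, linear_mem_maxLinearDifferences 0⟩
    (fun _ hf _ hg => inf_mem_maxLinearDifferences hf hg)
    (fun _ hf _ hg => sup_mem_maxLinearDifferences hf hg)
    separatesPointsStrongly_maxLinearDifferences

end MaxLinear

/-! ### Guessing probabilities as Blackwell integrals -/

section Guessing

variable {X Y : Type*} [Fintype X] [Fintype Y]

/-- The coefficient vectors `p (u, ·)`. -/
def jointRows {m : ℕ+} (p : stdSimplex ℝ (Fin m × X)) : Fin m → X → ℝ := fun u x => p (u, x)

/-- The objective is linear in `D(·|y)`, separately for each `y`, so a deterministic decoder is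
optimal and the maximum can be taken column by column. -/
theorem probCorrect_eq_sum_maxLinear {m : ℕ+} (p : stdSimplex ℝ (Fin m × X)) (W : DMC X Y) :
    probCorrect p W = ∑ y, maxLinear (jointRows p) fun x => W x y := by
  have hD : ∀ D : DMC Y (Fin m), probCorrectWith p W D =
      ∑ y, ∑ u, D y u * ∑ x, jointRows p u x * W x y := by
    intro D
    rw [probCorrectWith, Finset.sum_comm' (t' := Finset.univ) (s' := fun _ => Finset.univ)
      (by simp)]
    simp only [Finset.mul_sum, jointRows]
    rw [Finset.sum_comm]
    simp only [Finset.sum_comm (γ := X) (α := Y)]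
    rw [Finset.sum_comm]
    refine Finset.sum_congr rfl fun y _ => Finset.sum_congr rfl fun u _ =>
      Finset.sum_congr rfl fun x _ => ?_
    ring
  refine le_antisymm (ciSup_le fun D => ?_) ?_
  · rw [hD]
    refine Finset.sum_le_sum fun y _ => ?_
    calc ∑ u, D y u * ∑ x, jointRows p u x * W x y
        ≤ ∑ u, D y u * maxLinear (jointRows p) fun x => W x y :=
          Finset.sum_le_sum fun u _ => mul_le_mul_of_nonneg_left
            (le_maxLinear (jointRows p) (fun x => W x y) u) (stdSimplex.zero_le _ _)
      _ = _ := by rw [← Finset.sum_mul, stdSimplex.sum_eq_one, one_mul]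
  · classical
    choose u hu using fun y => exists_eq_maxLinear (jointRows p) fun x => W x y
    let D : DMC Y (Fin m) := fun y => ⟨Pi.single (u y) 1, single_mem_stdSimplex ℝ (u y)⟩
    have hDu : ∀ y v, D y v = if v = u y then 1 else 0 := fun y v =>
      Pi.single_apply (u y) (1 : ℝ) v
    refine le_trans (le_of_eq ?_) (le_ciSup (bddAbove_probCorrectWith p W) D)
    rw [hD]
    refine Finset.sum_congr rfl fun y _ => ?_
    simp [hDu, hu]

theorem integrable_continuousMap (μ : ProbabilityMeasure (stdSimplex ℝ X))
    (f : C(stdSimplex ℝ X, ℝ)) : Integrable f (μ : Measure (stdSimplex ℝ X)) :=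
  (BoundedContinuousFunction.mkOfCompact f).integrable _

variable [Nonempty X]

theorem integral_blackwellMeasure_eq_sum (W : DMC X Y) (f : C(stdSimplex ℝ X, ℝ)) :
    ∫ q, f q ∂(blackwellMeasure W) = ∑ y, outputProb W y * f (posterior W y) := by
  rw [blackwellMeasure_eq, integral_finsetSum_measure]
  · simp only [integral_smul_measure, integral_dirac, smul_eq_mul,
      ENNReal.toReal_ofReal (outputProb_nonneg W _)]
  · intro y _
    exact (integrable_dirac (by simp)).smul_measure ENNReal.ofReal_ne_top

/-- The integral of a continuous function against the Blackwell measure. -/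
def EquivDMC.integral (w : EquivDMC X) (f : C(stdSimplex ℝ X, ℝ)) : ℝ :=
  ∫ q, f q ∂((w.blackwell X).1 : Measure (stdSimplex ℝ X))

theorem EquivDMC.integral_sub (w : EquivDMC X) (f g : C(stdSimplex ℝ X, ℝ)) :
    w.integral (f - g) = w.integral f - w.integral g :=
  MeasureTheory.integral_sub (integrable_continuousMap _ f) (integrable_continuousMap _ g)

theorem EquivDMC.abs_integral_sub_le (w : EquivDMC X) (f g : C(stdSimplex ℝ X, ℝ)) :
    |w.integral f - w.integral g| ≤ dist f g := by
  rw [← w.integral_sub]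
  have h := norm_integral_le_of_norm_le_const (μ := ((w.blackwell X).1 : Measure (stdSimplex ℝ X)))
    (f := fun q => (f - g) q) (C := dist f g) (ae_of_all _ fun q => by
      rw [ContinuousMap.sub_apply, ← dist_eq_norm]
      exact ContinuousMap.dist_apply_le_dist q)
  rwa [probReal_univ, mul_one] at h

theorem EquivDMC.probCorrect_eq_integral {m : ℕ+} (p : stdSimplex ℝ (Fin m × X))
    (w : EquivDMC X) :
    w.probCorrect p = Fintype.card X * w.integral (maxLinearMap (jointRows p)) := by
  have hc : (Fintype.card X : ℝ) ≠ 0 := card_pos.ne'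
  induction w using Quotient.inductionOn with
  | h W =>
  change DMCSpace.probCorrect p W.2 = Fintype.card X *
    ∫ q, maxLinearMap (jointRows p) q ∂(blackwellMeasure W.2)
  rw [integral_blackwellMeasure_eq_sum, probCorrect_eq_sum_maxLinear, Finset.mul_sum]
  refine Finset.sum_congr rfl fun y _ => ?_
  -- Homogeneity moves the weights `P_W^o(y)` and `|X|` inside the maximum, where they turn the
  -- posterior back into the column of `W`.
  rw [maxLinearMap_apply, ← maxLinear_smul _ (outputProb_nonneg _ _),
    ← maxLinear_smul _ card_pos.le]
  congr 1
  funext x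
  rw [outputProb_mul_posterior, mul_inv_cancel_left₀ hc]

/-- Up to a positive factor and an additive constant, a maximum of linear functionals comes from
a joint distribution. -/
theorem exists_maxLinearMap_eq {m : ℕ+} (a : Fin m → X → ℝ) :
    ∃ (t c : ℝ) (p : stdSimplex ℝ (Fin m × X)),
      maxLinearMap a = t • maxLinearMap (jointRows p) - ContinuousMap.const _ c := by
  -- The shift makes every coefficient strictly positive, so the total `t` is positive and division
  -- by it gives a joint distribution.
  let c : ℝ := 1 + ∑ u, ∑ x, |a u x|
  have hpos : ∀ u x, 0 < a u x + c := by
    intro u x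
    have h1 : |a u x| ≤ ∑ x, |a u x| :=
      Finset.single_le_sum (f := fun x => |a u x|) (fun _ _ => abs_nonneg _) (Finset.mem_univ x)
    have h2 : ∑ x, |a u x| ≤ ∑ u, ∑ x, |a u x| :=
      Finset.single_le_sum (f := fun u => ∑ x, |a u x|)
        (fun _ _ => Finset.sum_nonneg fun _ _ => abs_nonneg _) (Finset.mem_univ u)
    have h3 := neg_abs_le (a u x)
    simp only [c]
    linarith
  let t : ℝ := ∑ ux : Fin m × X, (a ux.1 ux.2 + c)
  have ht : 0 < t := Finset.sum_pos (fun _ _ => hpos _ _) Finset.univ_nonempty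
  let p : stdSimplex ℝ (Fin m × X) := ⟨fun ux => t⁻¹ * (a ux.1 ux.2 + c),
    fun ux => mul_nonneg (inv_nonneg.2 ht.le) (hpos _ _).le, by
      rw [← Finset.mul_sum]; exact inv_mul_cancel₀ ht.ne'⟩
  have hp : ∀ u x, t * jointRows p u x = a u x + c := fun u x => mul_inv_cancel_left₀ ht.ne' _
  refine ⟨t, c, p, ?_⟩
  ext q
  change maxLinear a q = t * maxLinear (jointRows p) q - c
  rw [← smul_maxLinear _ ht.le]
  simp only [hp, maxLinear_add_const, add_sub_cancel_right]

theorem EquivDMC.integral_smul_sub_const (w : EquivDMC X) (t c : ℝ) (f : C(stdSimplex ℝ X, ℝ)) :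
    w.integral (t • f - ContinuousMap.const _ c) = t * w.integral f - c := by
  rw [w.integral_sub]
  congr 1
  · exact integral_const_mul t _
  · simp [EquivDMC.integral]

end Guessing

/-! ### Comparison of the two topologies -/

section Comparison

open Filter Topology

variable {X : Type*} [Fintype X]

/-- Each row `p(u, ·)` has mass at most 1, so it is 1-Lipschitz for the sup distance on the simplex.
The constant depends on neither `m` nor `p`, which gives equicontinuity of the whole family. -/
theorem abs_maxLinear_jointRows_sub_le {m : ℕ+} (p : stdSimplex ℝ (Fin m × X))
    (q q' : stdSimplex ℝ X) :
    |maxLinear (jointRows p) q - maxLinear (jointRows p) q'| ≤ dist q q' := by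
  have key : ∀ q q' : stdSimplex ℝ X,
      maxLinear (jointRows p) q - maxLinear (jointRows p) q' ≤ dist q q' := by
    intro q q'
    obtain ⟨u, hu⟩ := exists_eq_maxLinear (jointRows p) q
    have h1 := le_maxLinear (jointRows p) q' u
    have h2 : ∑ x, jointRows p u x * (q x - q' x) ≤ ∑ x, jointRows p u x * dist q q' :=
      Finset.sum_le_sum fun x _ => mul_le_mul_of_nonneg_left
        ((le_abs_self _).trans (dist_le_pi_dist (q : X → ℝ) q' x)) (stdSimplex.zero_le _ _)
    have h3 : ∑ x, jointRows p u x ≤ 1 := by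
      rw [← stdSimplex.sum_eq_one p, Fintype.sum_prod_type]
      exact Finset.single_le_sum (f := fun u => ∑ x, p (u, x))
        (fun _ _ => Finset.sum_nonneg fun _ _ => stdSimplex.zero_le _ _) (Finset.mem_univ u)
    have h4 := mul_le_mul_of_nonneg_right h3 (dist_nonneg (x := q) (y := q'))
    simp only [mul_sub, Finset.sum_sub_distrib, ← Finset.sum_mul] at h2
    linarith
  exact abs_sub_le_iff.2 ⟨key q q', dist_comm q q' ▸ key q' q⟩

theorem maxLinear_jointRows_mem_Icc {m : ℕ+} (p : stdSimplex ℝ (Fin m × X))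
    (q : stdSimplex ℝ X) : maxLinear (jointRows p) q ∈ Set.Icc (0 : ℝ) 1 := by
  obtain ⟨u, hu⟩ := exists_eq_maxLinear (jointRows p) q
  rw [← hu]
  refine ⟨Finset.sum_nonneg fun x _ => mul_nonneg (stdSimplex.zero_le _ _)
    (stdSimplex.zero_le _ _), ?_⟩
  rw [← stdSimplex.sum_eq_one q]
  exact Finset.sum_le_sum fun x _ =>
    mul_le_of_le_one_left (stdSimplex.zero_le _ _) (stdSimplex.le_one _ _)

/-- The payoff functions of all joint distributions form a totally bounded family. -/
theorem totallyBounded_maxLinearMap_jointRows :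
    TotallyBounded (Set.range fun p : Σ m : ℕ+, stdSimplex ℝ (Fin m × X) =>
      BoundedContinuousFunction.mkOfCompact (maxLinearMap (jointRows p.2))) := by
  refine (BoundedContinuousFunction.arzela_ascoli (Set.Icc (0 : ℝ) 1) isCompact_Icc _ ?_
    ?_).totallyBounded.subset subset_closure
  · rintro _ q ⟨p, rfl⟩
    exact maxLinear_jointRows_mem_Icc p.2 q
  · refine Metric.equicontinuous_of_continuity_modulus id tendsto_id _ ?_
    rintro q q' ⟨_, p, rfl⟩
    exact abs_maxLinear_jointRows_sub_le p.2 q q'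

theorem abs_probCorrect_sub_le_noisinessDist {m : ℕ+} (p : stdSimplex ℝ (Fin m × X))
    (w w' : EquivDMC X) : |w.probCorrect p - w'.probCorrect p| ≤ noisinessDist w w' :=
  le_ciSup (bddAbove_noisiness w w') (⟨m, p⟩ : Σ m : ℕ+, stdSimplex ℝ (Fin m × X))

variable [Nonempty X]

/-- Coinducing along a bijection is inducing along its inverse; in this form neighbourhoods are
pullbacks. -/
theorem weakStarTopology_eq_induced :
    weakStarTopology X = TopologicalSpace.induced (EquivDMC.blackwell X) inferInstance := by
  rw [weakStarTopology, canonicalBijection, Equiv.coinduced_symm]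
  rfl

theorem weakStarTopology_le_noisinessTopology : weakStarTopology X ≤ noisinessTopology X := by
  let := noisinessMetric X
  refine le_of_nhds_le_nhds fun w => ?_
  rw [weakStarTopology_eq_induced, nhds_induced]
  refine Metric.nhds_basis_ball.ge_iff.2 fun ε hε => ?_
  have hc : (0 : ℝ) < Fintype.card X := card_pos
  -- Replacing a payoff by a nearby net element costs `δ` for each of the two measures, and
  -- comparing the measures on the net costs a third `δ`. The inequality with `ε` is strict because
  -- the supremum only inherits a weak bound.
  obtain ⟨δ, hδ, hδε⟩ : ∃ δ > 0, (Fintype.card X : ℝ) * (3 * δ) < ε := by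
    refine ⟨ε / (4 * Fintype.card X), by positivity, ?_⟩
    field_simp
    norm_num
  obtain ⟨s, hs, hcover⟩ := Metric.totallyBounded_iff.1
    (totallyBounded_maxLinearMap_jointRows (X := X)) δ hδ
  -- A weak-* neighbourhood: finitely many integral conditions, one for each element of the net.
  have hnear : ∀ᶠ μ in 𝓝 (w.blackwell X), ∀ g ∈ s,
      |∫ q, g q ∂(μ.1 : Measure (stdSimplex ℝ X)) -
        ∫ q, g q ∂((w.blackwell X).1 : Measure (stdSimplex ℝ X))| < δ := by
    refine (Set.Finite.eventually_all hs).2 fun g _ => ?_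
    have hg : Continuous fun μ : MPbf X => ∫ q, g q ∂(μ.1 : Measure (stdSimplex ℝ X)) :=
      (ProbabilityMeasure.continuous_integral_boundedContinuousFunction g).comp
        continuous_subtype_val
    exact (Metric.tendsto_nhds.1 hg.continuousAt δ hδ)
  filter_upwards [hnear.comap (EquivDMC.blackwell X)] with w' hw'
  refine lt_of_le_of_lt (Real.iSup_le (fun p => ?_) (by positivity)) hδε
  rw [w'.probCorrect_eq_integral, w.probCorrect_eq_integral, ← mul_sub, abs_mul,
    abs_of_pos hc]
  refine mul_le_mul_of_nonneg_left ?_ hc.le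
  obtain ⟨g, hg, hpg⟩ : ∃ g ∈ s,
      BoundedContinuousFunction.mkOfCompact (maxLinearMap (jointRows p.2)) ∈ Metric.ball g δ := by
    simpa using hcover ⟨p, rfl⟩
  have hdist : dist (maxLinearMap (jointRows p.2)) g.toContinuousMap < δ := by
    rw [← BoundedContinuousFunction.dist_mkOfCompact]
    exact hpg
  have h1 := abs_le.1 (w'.abs_integral_sub_le (maxLinearMap (jointRows p.2)) g.toContinuousMap)
  have h2 := abs_le.1 (w.abs_integral_sub_le (maxLinearMap (jointRows p.2)) g.toContinuousMap)
  have h3 : |w'.integral g.toContinuousMap - w.integral g.toContinuousMap| < δ := hw' g hg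
  have h4 := abs_lt.1 h3
  exact abs_le.2 ⟨by linarith, by linarith⟩

/-- Each `P_c(p, ·)` is 1-Lipschitz for the noisiness distance, and the integral of a maximum of
linear functionals is an affine function of one such probability. -/
theorem tendsto_integral_of_mem_maxLinearDifferences {f : C(stdSimplex ℝ X, ℝ)}
    (hf : f ∈ maxLinearDifferences X) (w : EquivDMC X) :
    Tendsto (fun w' : EquivDMC X => w'.integral f) (@nhds _ (noisinessTopology X) w)
      (𝓝 (w.integral f)) := by
  let := noisinessMetric X
  have hprob : ∀ {m : ℕ+} (p : stdSimplex ℝ (Fin m × X)),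
      Tendsto (fun w' : EquivDMC X => w'.probCorrect p) (𝓝 w) (𝓝 (w.probCorrect p)) := by
    intro m p
    refine tendsto_iff_dist_tendsto_zero.2 (squeeze_zero (fun _ => dist_nonneg) (fun w' => ?_)
      (tendsto_iff_dist_tendsto_zero.1 (tendsto_id (x := 𝓝 w))))
    exact abs_probCorrect_sub_le_noisinessDist p w' w
  have hmax : ∀ {m : ℕ+} (a : Fin m → X → ℝ),
      Tendsto (fun w' : EquivDMC X => w'.integral (maxLinearMap a)) (𝓝 w)
        (𝓝 (w.integral (maxLinearMap a))) := by
    intro m a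
    obtain ⟨t, c, p, h⟩ := exists_maxLinearMap_eq a
    have hint : ∀ w' : EquivDMC X, w'.integral (maxLinearMap (jointRows p)) =
        (Fintype.card X : ℝ)⁻¹ * w'.probCorrect p := fun w' => by
      rw [w'.probCorrect_eq_integral, inv_mul_cancel_left₀ card_pos.ne']
    simp only [h, EquivDMC.integral_smul_sub_const, hint]
    exact (((hprob p).const_mul _).const_mul t).sub_const c
  obtain ⟨m, n, a, b, rfl⟩ := hf
  simp only [EquivDMC.integral_sub]
  exact (hmax a).sub (hmax b)

/-- An `ε/3` argument: the approximation error of `f` by a difference of maxima is the same for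
every probability measure, hence uniform in `w'`. -/
theorem tendsto_integral_noisiness (f : C(stdSimplex ℝ X, ℝ)) (w : EquivDMC X) :
    Tendsto (fun w' : EquivDMC X => w'.integral f) (@nhds _ (noisinessTopology X) w)
      (𝓝 (w.integral f)) := by
  let := noisinessMetric X
  refine Metric.tendsto_nhds.2 fun ε hε => ?_
  obtain ⟨g, hg, hfg⟩ : ∃ g ∈ maxLinearDifferences X, dist f g < ε / 3 :=
    Metric.mem_closure_iff.1 (by rw [closure_maxLinearDifferences]; trivial) _ (by positivity)
  filter_upwards [Metric.tendsto_nhds.1 (tendsto_integral_of_mem_maxLinearDifferences hg w)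
    (ε / 3) (by positivity)] with w' hw'
  have h1 := abs_le.1 (w'.abs_integral_sub_le f g)
  have h2 := abs_le.1 (w.abs_integral_sub_le f g)
  have h3 := abs_lt.1 hw'
  exact abs_lt.2 ⟨by linarith, by linarith⟩

theorem noisinessTopology_le_weakStarTopology : noisinessTopology X ≤ weakStarTopology X := by
  let := noisinessMetric X
  refine le_of_nhds_le_nhds fun w => ?_
  rw [weakStarTopology_eq_induced, nhds_induced, ← tendsto_iff_comap, tendsto_subtype_rng,
    ProbabilityMeasure.tendsto_iff_forall_integral_tendsto]
  exact fun f => tendsto_integral_noisiness f.toContinuousMap w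

end Comparison

end DMCSpace

theorem mainTheorem8 (X : Type*) [Fintype X] [Nonempty X] :
    DMCSpace.weakStarTopology X = DMCSpace.noisinessTopology X :=
  le_antisymm DMCSpace.weakStarTopology_le_noisinessTopology DMCSpace.noisinessTopology_le_weakStarTopology
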